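/- Let $p$ be a prime, let $k$ be a field of characteristic $p$ that is $F$-finite (i.e. $[k:k^p]<\infty$), let $n\ge 0$, $S=k[[x_1,\dots,x_n]]$ and $t\in\mathbb R_{>0}$. Let $\mathfrak a\subseteq S$ be a monomial ideal, i.e. an ideal generated by monomials $x^u=x_1^{u_1}\cdots x_n^{u_n}$, and let $\mathbf P_{\mathfrak a}\subseteq\mathbb R^n$ be its Newton polyhedron, the closed convex hull of $\{u\in\mathbb Z_{\ge 0}^n : x^u\in\mathfrak a\}$. Definitions. For a local ring $(R,\mathfrak m)$ of characteristic $p$, with residue field $\kappa$, and $e\ge 0$, let $F^e_*R$ be the additive group of $R$ with the $R$-module structure $r\cdot F^e_*x=F^e_*(r^{p^e}x)$, and let $\mathcal C_e=\operatorname{Hom}_R(F^e_*R,R)$; the product of $\varphi\in\mathcal C_{e_1}$ and $\psi\in\mathcal C_{e_2}$ is $\varphi\circ F^{e_1}_*\psi\in\mathcal C_{e_1+e_2}$. A Cartier subalgebra on $R$ is a family $\mathcal D$ of additive subgroups $\mathcal D_e\subseteq\mathcal C_e$ $(e\ge 0)$, closed under this product, with $\mathcal D_0=\mathcal C_0$ and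 $\mathcal D_e\ne 0$ for some $e>0$. In a direct sum decomposition $F^e_*R=\bigoplus_i M_i$ of $R$-modules, $M_j$ is a $\mathcal D$-summand if, for some isomorphism $M_j\cong R$, the projection $F^e_*R\to M_j\cong R$ lies in $\mathcal D_e$; the $F$-splitting number $a_e^{\mathcal D}$ is the maximal number of $\mathcal D$-summands in such a decomposition. Put $\alpha(R)=\log_p[\kappa:\kappa^p]$ and $\Gamma_{\mathcal D}=\{e\ge 0: a_e^{\mathcal D}\ne 0\}$. The $F$-signature is $$s(R,\mathcal D)=\lim_{e\in\Gamma_{\mathcal D},\ e\to\infty}\frac{a_e^{\mathcal D}}{p^{e(\dim R+\alpha(R))}},$$ and it is $0$ if $\Gamma_{\mathcal D}$ is finite. Let $\mathcal D=\mathcal C^{\mathfrak a^t}$ be the family with $\mathcal D_e=\mathcal C_e\cdot F^e_*\mathfrak a^{\lceil t(p^e-1)\rceil}$, the subgroup of $\mathcal C_e=\operatorname{Hom}_S(F^e_*S,S)$ generated by all maps $\varphi(F^e_*b\cdot{-})$ with $\varphi\in\mathcal C_e$ and $b\in\mathfrak a^{\lceil t(p^e-1)\rceil}$, and write $s(S,\mathfrak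 a^t)=s(S,\mathcal C^{\mathfrak a^t})$. Theorem. If $\mathfrak a\neq 0$, then $\mathcal C^{\mathfrak a^t}$ is a Cartier subalgebra on $S$. The limit defining $s(S,\mathfrak a^t)$ exists, and $$s(S,\mathfrak a^t)=\operatorname{vol}_{\mathbb R^n}\bigl(t\,\mathbf P_{\mathfrak a}\cap[0,1]^n\bigr),$$ the Euclidean volume of the intersection of $t\,\mathbf P_{\mathfrak a}$ with the unit cube. (For $\mathfrak a=0$ both sides are $0$.) In particular, for a given set of exponents of monomials generating $\mathfrak a$, the value depends neither on $k$ nor on $p$. -/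

import Mathlib

open Filter Topology MeasureTheory
open scoped Pointwise

noncomputable section

/-- `FPush p e R` is the `R`-module `F^e_* R`: the additive group of `R`, on which `r` acts as
multiplication by `r ^ (p ^ e)`. -/
def FPush (_p _e : ℕ) (R : Type*) : Type _ := R

namespace FPush

variable (p e : ℕ) (R : Type*) [CommRing R]

instance : AddCommGroup (FPush p e R) := inferInstanceAs (AddCommGroup R)

instance [Fact p.Prime] [CharP R p] : Module R (FPush p e R) :=
  letI : Module R (FPush p e R) := inferInstanceAs (Module R R)
  Module.compHom (FPush p e R) (iterateFrobenius R p e)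

/-- The bijection `x ↦ F^e_* x` from `R` to `F^e_* R`. -/
def of : R ≃+ FPush p e R := AddEquiv.refl R

variable {R}

theorem smul_of [Fact p.Prime] [CharP R p] (r x : R) :
    r • of p e R x = of p e R (r ^ p ^ e * x) := rfl

variable [Fact p.Prime] [CharP R p]

/-- Multiplication by `F^e_* b`, as an `R`-linear endomorphism of `F^e_* R`. -/
def mulMap (b : R) : FPush p e R →ₗ[R] FPush p e R where
  toFun x := of p e R (b * (of p e R).symm x)
  map_add' x y := by simp [mul_add]
  map_smul' r x := by
    obtain ⟨x, rfl⟩ := (of p e R).surjective x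
    simp only [smul_of, AddEquiv.symm_apply_apply, RingHom.id_apply]
    congr 1
    ring

end FPush

section Cartier

variable (p : ℕ) [Fact p.Prime] (R : Type*) [CommRing R] [CharP R p]

/-- The group `𝒞_e = Hom_R(F^e_* R, R)` of `p^{-e}`-linear maps on `R`. -/
abbrev CartierMap (e : ℕ) : Type _ := FPush p e R →ₗ[R] R

variable {R}

/-- The product of `φ ∈ 𝒞_{e₁}` and `ψ ∈ 𝒞_{e₂}` in the Cartier algebra, namely
`φ ∘ F^{e₁}_* ψ ∈ 𝒞_{e₁ + e₂}`: as additive maps on `R` this is the composition. -/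
def cartierMul {e₁ e₂ : ℕ} (φ : CartierMap p R e₁) (ψ : CartierMap p R e₂) :
    CartierMap p R (e₁ + e₂) where
  toFun x := φ (FPush.of p e₁ R (ψ (FPush.of p e₂ R ((FPush.of p (e₁ + e₂) R).symm x))))
  map_add' x y := by simp
  map_smul' r x := by
    obtain ⟨x, rfl⟩ := (FPush.of p (e₁ + e₂) R).surjective x
    rw [FPush.smul_of, AddEquiv.symm_apply_apply, AddEquiv.symm_apply_apply, pow_add, pow_mul,
      ← FPush.smul_of, map_smul, smul_eq_mul, ← FPush.smul_of, map_smul, RingHom.id_apply]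

/-- A graded family of additive subgroups `𝒟_e ⊆ 𝒞_e` is a Cartier subalgebra on `R` if
`𝒟_0 = 𝒞_0`, it is closed under the multiplication of the Cartier algebra, and `𝒟_e ≠ 0` for some
`e > 0`. (An additive subgroup is automatically an `𝔽_p`-subspace.) -/
structure IsCartierSubalgebra (D : ∀ e, AddSubgroup (CartierMap p R e)) : Prop where
  zero_eq_top : D 0 = ⊤
  mul_mem : ∀ {e₁ e₂ : ℕ} {φ : CartierMap p R e₁} {ψ : CartierMap p R e₂},
    φ ∈ D e₁ → ψ ∈ D e₂ → cartierMul p φ ψ ∈ D (e₁ + e₂)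
  exists_ne_bot : ∃ e, 0 < e ∧ D e ≠ ⊥

/-- The subgroup `𝒞_e · F^e_* I` of `𝒞_e`, generated by the maps `φ(F^e_* b · _)` with `φ ∈ 𝒞_e`
and `b ∈ I`. -/
def cartierMulIdeal (e : ℕ) (I : Ideal R) : AddSubgroup (CartierMap p R e) :=
  AddSubgroup.closure {χ | ∃ φ : CartierMap p R e, ∃ b ∈ I, χ = φ ∘ₗ FPush.mulMap p e b}

/-- The Cartier algebra `𝒞^{𝔞^t}` of the pair `(R, 𝔞^t)`, whose degree `e` part is
`𝒞_e · F^e_* 𝔞^{⌈t(p^e - 1)⌉}`. -/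
def pairCartier (𝔞 : Ideal R) (t : ℝ) (e : ℕ) : AddSubgroup (CartierMap p R e) :=
  cartierMulIdeal p e (𝔞 ^ ⌈t * ((p : ℝ) ^ e - 1)⌉₊)

/-- In an internal direct sum decomposition `F^e_* R = ⨁ M_i`, the summand `M_j` is a
`𝒟`-summand if there is an isomorphism `M_j ≃ R` for which the composite
`F^e_* R → M_j ≃ R` with the projection belongs to `𝒟_e`. -/
def IsDSummand {e : ℕ} (De : AddSubgroup (CartierMap p R e)) {m : ℕ}
    (M : Fin m → Submodule R (FPush p e R)) (hM : DirectSum.IsInternal M) (j : Fin m) : Prop :=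
  ∃ f : M j ≃ₗ[R] R,
    f.toLinearMap ∘ₗ DirectSum.component R (Fin m) (fun i => M i) j ∘ₗ
      (LinearEquiv.ofBijective (DirectSum.coeLinearMap M) hM).symm.toLinearMap ∈ De

/-- The `e`-th `F`-splitting number `a_e^𝒟`: the maximal number of `𝒟`-summands in a direct sum
decomposition of `F^e_* R` as an `R`-module. -/
def splittingNumber {e : ℕ} (De : AddSubgroup (CartierMap p R e)) : ℕ :=
  sSup {N | ∃ (m : ℕ) (M : Fin m → Submodule R (FPush p e R)) (hM : DirectSum.IsInternal M),
    N = Nat.card {j : Fin m // IsDSummand p De M hM j}}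

/-- The semigroup `Γ_𝒟 = {e ≥ 0 | a_e^𝒟 ≠ 0}`. -/
def splittingSemigroup (D : ∀ e, AddSubgroup (CartierMap p R e)) : Set ℕ :=
  {e | splittingNumber p (D e) ≠ 0}

end Cartier

/-- A ring of characteristic `p` is `F`-finite if `F_* R` is a finitely generated `R`-module. -/
def IsFFinite (p : ℕ) [Fact p.Prime] (R : Type*) [CommRing R] [CharP R p] : Prop :=
  Module.Finite R (FPush p 1 R)

instance residueField_charP (p : ℕ) [hp : Fact p.Prime] (R : Type*) [CommRing R] [CharP R p]
    [IsLocalRing R] : CharP (IsLocalRing.ResidueField R) p :=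
  (CharP.charP_iff_prime_eq_zero hp.out).mpr (by
    rw [← map_natCast (IsLocalRing.residue R) p, CharP.cast_eq_zero, map_zero])

instance mvPowerSeries_charP (p : ℕ) (σ k : Type*) [CommRing k] [CharP k p] :
    CharP (MvPowerSeries σ k) p :=
  charP_of_injective_ringHom (f := (MvPowerSeries.C : k →+* MvPowerSeries σ k))
    (fun a b h => by simpa using congrArg MvPowerSeries.constantCoeff h) p

/-- `α(R) = log_p [k : k^p]`, where `k` is the residue field of `R`. -/
def alphaInv (p : ℕ) [Fact p.Prime] (R : Type*) [CommRing R] [CharP R p] [IsLocalRing R] : ℝ :=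
  Real.logb p (Module.finrank (frobenius (IsLocalRing.ResidueField R) p).fieldRange
    (IsLocalRing.ResidueField R))

/-- The Krull dimension as a natural number (for rings of finite Krull dimension). -/
def krullDimNat (R : Type*) [CommRing R] : ℕ := ((ringKrullDim R).unbotD 0).toNat

/-- `HasFSignature p D s` says that the `F`-signature `s(R, 𝒟)` of the local ring `R` exists and
equals `s`: the quotients `a_e^𝒟 / p^{e (d + α(R))}`, with `d = dim R`, converge to `s` as
`e ∈ Γ_𝒟` tends to infinity. If there are only finitely many `e` with `a_e^𝒟 ≠ 0`, then the
`F`-signature is `0` by convention (this is then the limit of the quotients over all `e`). -/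
structure HasFSignature (p : ℕ) [Fact p.Prime] {R : Type*} [CommRing R] [CharP R p]
    [IsLocalRing R] (D : ∀ e, AddSubgroup (CartierMap p R e)) (s : ℝ) : Prop where
  tendsto : Tendsto
    (fun e : ℕ => (splittingNumber p (D e) : ℝ) /
      (p : ℝ) ^ ((e : ℝ) * ((krullDimNat R : ℝ) + alphaInv p R)))
    (atTop ⊓ 𝓟 (splittingSemigroup p D)) (𝓝 s)
  eq_zero_of_finite : (splittingSemigroup p D).Finite → s = 0

section Monomial

variable {n : ℕ} {k : Type*} [Field k]

/-- A monomial ideal of `k⟦x_1, …, x_n⟧` is an ideal generated by a set of monomials `x^u`. -/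
def IsMonomialIdeal (𝔞 : Ideal (MvPowerSeries (Fin n) k)) : Prop :=
  ∃ A : Set (Fin n →₀ ℕ), 𝔞 = Ideal.span ((fun u => MvPowerSeries.monomial u (1 : k)) '' A)

/-- The Newton polyhedron of `𝔞`: the closed convex hull in `ℝ^n` of the exponents `u` of the
monomials `x^u ∈ 𝔞`. -/
def newtonPolyhedron (𝔞 : Ideal (MvPowerSeries (Fin n) k)) : Set (Fin n → ℝ) :=
  closedConvexHull ℝ
    {v | ∃ u : Fin n →₀ ℕ, MvPowerSeries.monomial u (1 : k) ∈ 𝔞 ∧ v = fun i => (u i : ℝ)}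

end Monomial

end

/-! Put q = p^e. If λ_j is a basis of F^e_* k over k, the elements λ_j x^u with 0 ≤ u_i < q form a
basis of F^e_* S (`monomialBasis`). For a monomial ideal I this basis decides everything: the
coordinate function at λ_j x^u lies in 𝒞_e · F^e_* I when x^(q-1-u) ∈ I, and otherwise every map in
that group sends λ_j x^u into the maximal ideal. Linear algebra over the residue field
(`card_isDSummand_le`) then shows that a_e is [k : k^p]^e times the number of w ∈ [0, q-1]^n with
x^w ∈ I (`splittingNumber_cartierMulIdeal`). The first factor cancels against the denominator.

It remains to count such w for I = 𝔞^N, N = ⌈t(q-1)⌉. Let C be the convex hull of the exponents of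
𝔞. If N > 0, then x^w ∈ 𝔞^N forces w ∈ N C; conversely w ∈ (N+n+1) C suffices, by Carathéodory's
theorem. The bounded gap between the dilation factors and the boundary effects cost o(q^n), so
division by q^n leaves vol(tC ∩ [0,1]^n) (`tendsto_card_lattice_points`). Replacing C by its
closure, the Newton polyhedron, does not change the volume, because the boundary of a convex set is
null. -/

noncomputable section

/-! ### Krull dimension of the power series ring. -/

section KrullDimension

/-- X is a nonzerodivisor in the maximal ideal with quotient A, so killing it lowers the dimension
by exactly one. -/
theorem ringKrullDim_powerSeries_of_isLocalRing (A : Type*) [CommRing A] [IsNoetherianRing A]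
    [IsDomain A] [IsLocalRing A] :
    ringKrullDim (PowerSeries A) = ringKrullDim A + 1 := by
  have hker : RingHom.ker (PowerSeries.constantCoeff (R := A)) =
      Ideal.span {(PowerSeries.X : PowerSeries A)} := by
    ext f
    rw [RingHom.mem_ker, Ideal.mem_span_singleton, PowerSeries.X_dvd_iff]
  have e : (PowerSeries A ⧸ Ideal.span {(PowerSeries.X : PowerSeries A)}) ≃+* A :=
    (Ideal.quotEquivOfEq hker.symm).trans
      (RingHom.quotientKerEquivOfSurjective PowerSeries.constantCoeff_surj)
  have hX : (PowerSeries.X : PowerSeries A) ∈ IsLocalRing.maximalIdeal (PowerSeries A) := by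
    rw [IsLocalRing.mem_maximalIdeal, mem_nonunits_iff, PowerSeries.isUnit_iff_constantCoeff]
    simp
  rw [← ringKrullDim_quotient_span_singleton_succ_eq_ringKrullDim_of_mem_nonZeroDivisors
    (mem_nonZeroDivisors_of_ne_zero PowerSeries.X_ne_zero) hX, ringKrullDim_eq_of_ringEquiv e]

/-- Both claims go through one induction, since the dimension step needs the smaller ring to be
Noetherian. -/
theorem MvPowerSeries.isNoetherianRing_and_ringKrullDim (k : Type*) [Field k] (n : ℕ) :
    IsNoetherianRing (MvPowerSeries (Fin n) k) ∧
      ringKrullDim (MvPowerSeries (Fin n) k) = n := by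
  induction n with
  | zero =>
    have e : MvPowerSeries (Fin 0) k ≃+* k :=
      RingEquiv.ofBijective MvPowerSeries.constantCoeff
        ⟨fun f g h => by
          ext d
          rw [Subsingleton.elim d 0]
          simpa using h, fun a => ⟨MvPowerSeries.C a, MvPowerSeries.constantCoeff_C a⟩⟩
    exact ⟨isNoetherianRing_of_ringEquiv k e.symm, by
      rw [ringKrullDim_eq_of_ringEquiv e, ringKrullDim_eq_zero_of_field]; rfl⟩
  | succ n ih =>
    obtain ⟨_, hdim⟩ := ih
    have : IsDomain (MvPowerSeries (Fin n) k) := NoZeroDivisors.to_isDomain _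
    have e := (MvPowerSeries.finSuccEquiv k n).toRingEquiv
    exact ⟨isNoetherianRing_of_ringEquiv _ e.symm, by
      rw [ringKrullDim_eq_of_ringEquiv e, ringKrullDim_powerSeries_of_isLocalRing, hdim]; simp⟩

theorem krullDimNat_mvPowerSeries (k : Type*) [Field k] (n : ℕ) :
    krullDimNat (MvPowerSeries (Fin n) k) = n := by
  rw [krullDimNat, (MvPowerSeries.isNoetherianRing_and_ringKrullDim k n).2]
  rfl

end KrullDimension

/-! ### The residue degree [k : k^p] and the normalising denominator. -/

section ResidueDegree

variable (p : ℕ) [Fact p.Prime] (k : Type*) [Field k] [CharP k p]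

/-- `F^{e+1}_* k` is a direct sum of `[k : k^p]` copies of `F^e_* k`. -/
def FPush.succEquiv {ι : Type*} [Fintype ι] (b : Module.Basis ι k (FPush p 1 k)) (e : ℕ) :
    FPush p (e + 1) k ≃ₗ[k] (ι → FPush p e k) :=
  LinearEquiv.symm <|
  { toFun := fun g => FPush.of p (e + 1) k ((FPush.of p 1 k).symm
      (b.equivFun.symm fun i => (FPush.of p e k).symm (g i)))
    map_add' := fun g h => by
      rw [← map_add, ← map_add, ← map_add]
      congr 3
    map_smul' := fun r g => by
      rw [RingHom.id_apply, FPush.smul_of]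
      congr 1
      have : (fun i => (FPush.of p e k).symm ((r • g) i)) =
          r ^ p ^ e • fun i => (FPush.of p e k).symm (g i) := by
        funext i
        rfl
      rw [this, map_smul, pow_succ, pow_mul]
      obtain ⟨y, hy⟩ := (FPush.of p 1 k).surjective
        (b.equivFun.symm fun i => (FPush.of p e k).symm (g i))
      rw [← hy, FPush.smul_of, pow_one]
      rfl
    invFun := fun x i => FPush.of p e k
      (b.equivFun (FPush.of p 1 k ((FPush.of p (e + 1) k).symm x)) i)
    left_inv := fun g => by
      simp only [AddEquiv.symm_apply_apply, AddEquiv.apply_symm_apply, LinearEquiv.apply_symm_apply]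
    right_inv := fun x => by simp }

theorem FPush.finite_and_finrank (h : IsFFinite p k) (e : ℕ) :
    Module.Finite k (FPush p e k) ∧
      Module.finrank k (FPush p e k) = Module.finrank k (FPush p 1 k) ^ e := by
  have : Module.Finite k (FPush p 1 k) := h
  induction e with
  | zero =>
    let f : k ≃ₗ[k] FPush p 0 k :=
      { FPush.of p 0 k with
        map_smul' := fun r x => by
          change FPush.of p 0 k (r * x) = r • FPush.of p 0 k x
          rw [FPush.smul_of]; simp }
    exact ⟨Module.Finite.equiv f, by rw [← f.finrank_eq]; simp⟩
  | succ e ih =>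
    obtain ⟨_, hr⟩ := ih
    let f := FPush.succEquiv p k (Module.finBasis k (FPush p 1 k)) e
    exact ⟨Module.Finite.equiv f.symm, by
      rw [f.finrank_eq, Module.finrank_pi_fintype]; simp [hr, pow_succ, mul_comm]⟩

theorem MvPowerSeries.ker_constantCoeff (σ : Type*) :
    RingHom.ker (MvPowerSeries.constantCoeff (σ := σ) (R := k)) =
      IsLocalRing.maximalIdeal (MvPowerSeries σ k) := by
  ext f
  rw [RingHom.mem_ker, IsLocalRing.mem_maximalIdeal, mem_nonunits_iff,
    MvPowerSeries.isUnit_iff_constantCoeff, isUnit_iff_ne_zero, not_not]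

/-- The residue field of `k⟦σ⟧` is `k`. -/
def MvPowerSeries.residueFieldEquiv (σ : Type*) :
    IsLocalRing.ResidueField (MvPowerSeries σ k) ≃+* k :=
  (Ideal.quotEquivOfEq (MvPowerSeries.ker_constantCoeff k σ).symm).trans
    (RingHom.quotientKerEquivOfSurjective
      (fun a => ⟨MvPowerSeries.C a, MvPowerSeries.constantCoeff_C a⟩))

/-- K over K^p and F_* k over k are the same module up to the isomorphism r ↦ r^p of scalars. -/
theorem finrank_frobenius_fieldRange (K : Type*) [Field K] [CharP K p] (ρ : K ≃+* k) :
    Module.finrank (frobenius K p).fieldRange K = Module.finrank k (FPush p 1 k) := by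
  let i : k → (frobenius K p).fieldRange := fun r => ⟨frobenius K p (ρ.symm r), ρ.symm r, rfl⟩
  let j : FPush p 1 k ≃+ K := (FPush.of p 1 k).symm.trans ρ.symm.toAddEquiv
  have hi : Function.Bijective i := by
    refine ⟨fun a b hab => ?_, fun ⟨y, x, hx⟩ => ⟨ρ x, Subtype.ext (by simpa [i] using hx)⟩⟩
    exact ρ.symm.injective (frobenius_inj K p (congrArg Subtype.val hab))
  have hj : ∀ (r : k) (m : FPush p 1 k), j (r • m) = i r • j m := by
    intro r m
    obtain ⟨m, rfl⟩ := (FPush.of p 1 k).surjective m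
    rw [FPush.smul_of, Subfield.smul_def]
    simp [i, j, frobenius_def]
  have := lift_rank_eq_of_equiv_equiv i j hi hj
  simpa [Module.finrank] using (congrArg Cardinal.toNat this).symm

theorem rpow_mul_krullDimNat_add_alphaInv (h : IsFFinite p k) (n e : ℕ) :
    (p : ℝ) ^ ((e : ℝ) * ((krullDimNat (MvPowerSeries (Fin n) k) : ℝ) +
      alphaInv p (MvPowerSeries (Fin n) k))) =
      ((p : ℝ) ^ e) ^ n * Module.finrank k (FPush p e k) := by
  have hp : 1 < (p : ℝ) := by exact_mod_cast (Fact.out : p.Prime).one_lt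
  have : Module.Finite k (FPush p 1 k) := h
  have : Nontrivial (FPush p 1 k) := inferInstanceAs (Nontrivial k)
  have hd : (0 : ℝ) < Module.finrank k (FPush p 1 k) := by
    exact_mod_cast Module.finrank_pos
  rw [krullDimNat_mvPowerSeries, alphaInv,
    finrank_frobenius_fieldRange p k _ (MvPowerSeries.residueFieldEquiv k (Fin n)),
    (FPush.finite_and_finrank p k h e).2, mul_add, Real.rpow_add (by linarith), mul_comm (e : ℝ)
      (Real.logb _ _), Real.rpow_mul (by linarith), Real.rpow_mul (by linarith),
    Real.rpow_logb (by linarith) (by linarith) hd]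
  norm_cast

end ResidueDegree

/-! ### Lattice points in dilates of an upward closed set. -/

section LatticePointCount

variable {ι : Type*} [Fintype ι]

theorem volume_real_Icc_zero_const {r : ℝ} (hr : 0 ≤ r) :
    volume.real (Set.Icc (0 : ι → ℝ) fun _ => r) = r ^ Fintype.card ι := by
  rw [measureReal_def, Real.volume_Icc_pi_toReal (a := 0) (fun _ => hr)]
  simp

theorem volume_Icc_zero_ne_top (r : ι → ℝ) : volume (Set.Icc (0 : ι → ℝ) r) ≠ ⊤ :=
  isCompact_Icc.measure_lt_top.ne

theorem card_le_volume_of_cubes_subset (G : Finset (ι → ℕ)) {Y : Set (ι → ℝ)}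
    (hfin : volume Y ≠ ⊤)
    (hY : ∀ w ∈ G, ∀ z : ι → ℝ, (∀ i, (w i : ℝ) ≤ z i ∧ z i < w i + 1) → z ∈ Y) :
    (G.card : ℝ) ≤ volume.real Y := by
  let Q : (ι → ℕ) → Set (ι → ℝ) := fun w => Set.univ.pi fun i => Set.Ico (w i : ℝ) (w i + 1)
  have hvol : ∀ w, volume (Q w) = 1 := fun w => by
    simp [Q, Real.volume_pi_Ico]
  have hdisj : Set.PairwiseDisjoint (G : Set (ι → ℕ)) Q := by
    intro w _ w' _ hne
    refine Set.disjoint_left.mpr fun z hz hz' => hne (funext fun i => ?_)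
    have h1 := hz i trivial
    have h2 := hz' i trivial
    have a : (w i : ℝ) < w' i + 1 := h1.1.trans_lt h2.2
    have b : (w' i : ℝ) < w i + 1 := h2.1.trans_lt h1.2
    norm_cast at a b
    omega
  have hm : ∀ w ∈ G, MeasurableSet (Q w) := fun w _ =>
    MeasurableSet.univ_pi fun i => measurableSet_Ico
  have : (G.card : ENNReal) = volume (⋃ w ∈ G, Q w) := by
    rw [measure_biUnion_finset hdisj hm]
    simp [hvol]
  have hle : (G.card : ENNReal) ≤ volume Y := by
    rw [this]
    refine measure_mono (Set.iUnion₂_subset fun w hw z hz => hY w hw z fun i => hz i trivial)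
  simpa [measureReal_def] using ENNReal.toReal_mono hfin hle

theorem volume_le_card_of_subset_cubes (G : Finset (ι → ℕ)) {Y : Set (ι → ℝ)}
    (hY : ∀ z ∈ Y, ∃ w ∈ G, ∀ i, (w i : ℝ) - 1 ≤ z i ∧ z i ≤ w i) :
    volume.real Y ≤ G.card := by
  let Q : (ι → ℕ) → Set (ι → ℝ) := fun w => Set.Icc (fun i => (w i : ℝ) - 1) fun i => (w i : ℝ)
  have hvol : ∀ w, volume (Q w) = 1 := fun w => by
    simp [Q, Real.volume_Icc_pi]
  have hle : volume Y ≤ G.card := by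
    calc volume Y ≤ volume (⋃ w ∈ G, Q w) := measure_mono fun z hz => by
          obtain ⟨w, hw, h⟩ := hY z hz
          exact Set.mem_biUnion hw ⟨fun i => (h i).1, fun i => (h i).2⟩
      _ ≤ ∑ w ∈ G, volume (Q w) := measure_biUnion_finset_le _ _
      _ = G.card := by simp [hvol]
  simpa [measureReal_def] using ENNReal.toReal_mono (ENNReal.natCast_ne_top _) hle

/-- Enlarging the box adds at most the volume of the shell between the two boxes. -/
theorem volume_real_inter_Icc_le (A : Set (ι → ℝ)) {r s : ℝ} (hr : 0 ≤ r) (hrs : r ≤ s) :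
    volume.real (A ∩ Set.Icc 0 fun _ => s) ≤
      volume.real (A ∩ Set.Icc 0 fun _ => r) + (s ^ Fintype.card ι - r ^ Fintype.card ι) := by
  have hsub : (Set.Icc (0 : ι → ℝ) fun _ => r) ⊆ Set.Icc 0 fun _ => s :=
    Set.Icc_subset_Icc_right fun _ => hrs
  have hfs := volume_Icc_zero_ne_top fun _ : ι => s
  have hfr := volume_Icc_zero_ne_top fun _ : ι => r
  have hd : volume.real ((Set.Icc (0 : ι → ℝ) fun _ => s) \ Set.Icc 0 fun _ => r) =
      s ^ Fintype.card ι - r ^ Fintype.card ι := by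
    rw [measureReal_sdiff hsub measurableSet_Icc hfs, volume_real_Icc_zero_const hr,
      volume_real_Icc_zero_const (hr.trans hrs)]
  rw [← hd]
  refine (measureReal_mono ?_ ?_).trans (measureReal_union_le _ _)
  · rintro z ⟨hA, hz⟩
    by_cases h : z ∈ Set.Icc (0 : ι → ℝ) fun _ => r
    · exact Or.inl ⟨hA, h⟩
    · exact Or.inr ⟨hz, h⟩
  · exact measure_union_ne_top (measure_ne_top_of_subset Set.inter_subset_right hfr)
      (measure_ne_top_of_subset Set.sdiff_subset hfs)

theorem volume_real_smul_inter_Icc (C : Set (ι → ℝ)) (t : ℝ) {a : ℝ} (ha : 0 < a) :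
    volume.real ((t * a) • C ∩ Set.Icc 0 fun _ => a) =
      a ^ Fintype.card ι * volume.real (t • C ∩ Set.Icc 0 1) := by
  have : ((t * a) • C ∩ Set.Icc 0 fun _ => a) = a • (t • C ∩ Set.Icc 0 1) := by
    rw [Set.smul_set_inter₀ ha.ne', smul_smul, mul_comm a t]
    congr 1
    ext z
    rw [Set.mem_smul_set_iff_inv_smul_mem₀ ha.ne']
    simp only [Set.mem_Icc, Pi.le_def, Pi.smul_apply, smul_eq_mul, Pi.zero_apply, Pi.one_apply]
    refine and_congr (forall_congr' fun i => ?_) (forall_congr' fun i => ?_)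
    · rw [inv_mul_eq_div, le_div_iff₀ ha, zero_mul]
    · rw [inv_mul_eq_div, div_le_iff₀ ha, one_mul]
  rw [this, measureReal_def, Measure.addHaar_smul, ENNReal.toReal_mul]
  simp [abs_of_pos ha, ha.le, measureReal_def]

theorem smul_set_mem_of_le {ι : Type*} {C : Set (ι → ℝ)} (hup : ∀ x ∈ C, ∀ y, x ≤ y → y ∈ C)
    {s : ℝ}
    (hs : 0 < s) {x y : ι → ℝ} (hx : x ∈ s • C) (hxy : x ≤ y) : y ∈ s • C := by
  rw [Set.mem_smul_set_iff_inv_smul_mem₀ hs.ne'] at hx ⊢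
  exact hup _ hx _ (smul_le_smul_of_nonneg_left hxy (inv_nonneg.mpr hs.le))

/-- Upward closure lets unit cubes be compared with lattice points in both directions: the cube w +
[0,1)^n stays in the dilate containing w, and rounding a point up to a lattice point stays in its
dilate. Neither measurability nor convexity of C is needed. -/
theorem tendsto_card_lattice_points {C : Set (ι → ℝ)} (hup : ∀ x ∈ C, ∀ y, x ≤ y → y ∈ C)
    {t c : ℝ} (ht : 0 < t) (hc : 0 ≤ c) (G : ℕ → Finset (ι → ℕ))
    (hlt : ∀ q, ∀ w ∈ G q, ∀ i, w i < q)
    (hG : ∀ q, 2 ≤ q → ∀ w ∈ G q, (fun i => (w i : ℝ)) ∈ (t * ((q : ℝ) - 1)) • C)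
    (hG' : ∀ q, 2 ≤ q → ∀ w : ι → ℕ, (∀ i, w i < q) →
      (fun i => (w i : ℝ)) ∈ (t * (q : ℝ) + c) • C → w ∈ G q) :
    Tendsto (fun q : ℕ => ((G q).card : ℝ) / (q : ℝ) ^ Fintype.card ι) atTop
      (𝓝 (volume.real (t • C ∩ Set.Icc 0 1))) := by
  set V := volume.real (t • C ∩ Set.Icc 0 1)
  set n := Fintype.card ι
  have hupper : ∀ q : ℕ, 2 ≤ q →
      ((G q).card : ℝ) ≤ ((q : ℝ) - 1) ^ n * V + ((q : ℝ) ^ n - ((q : ℝ) - 1) ^ n) := by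
    intro q hq
    have hq' : (2 : ℝ) ≤ q := by exact_mod_cast hq
    have hpos : 0 < (q : ℝ) - 1 := by linarith
    -- The cubes lie in the box of side q, while the scaling factor matching t(q-1) is q-1; the
    -- shell pays for the difference.
    rw [← volume_real_smul_inter_Icc C t hpos]
    refine le_trans ?_ (volume_real_inter_Icc_le _ hpos.le (by linarith))
    refine card_le_volume_of_cubes_subset _
      (measure_ne_top_of_subset Set.inter_subset_right (volume_Icc_zero_ne_top _)) ?_
    intro w hw z hz
    refine ⟨smul_set_mem_of_le hup (mul_pos ht hpos) (hG q hq w hw) fun i => (hz i).1,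
      fun i => le_trans (Nat.cast_nonneg _) (hz i).1, fun i => (hz i).2.le.trans ?_⟩
    have := hlt q w hw i
    change (w i : ℝ) + 1 ≤ q
    exact_mod_cast this
  have hlower : ∀ q : ℕ, 2 ≤ q →
      ((q : ℝ) + c / t) ^ n * V - (((q : ℝ) + c / t) ^ n - ((q : ℝ) - 1) ^ n) ≤ (G q).card := by
    intro q hq
    have hq' : (2 : ℝ) ≤ q := by exact_mod_cast hq
    have hct : 0 ≤ c / t := by positivity
    have hpos : 0 < (q : ℝ) + c / t := by linarith
    -- The scale q + c/t is the one for which t(q + c/t) = tq + c. Only the box of side q-1 is kept,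
    -- so that rounding up gives coordinates below q.
    rw [← volume_real_smul_inter_Icc C t hpos, sub_le_iff_le_add]
    refine (volume_real_inter_Icc_le _ (r := (q : ℝ) - 1) (by linarith) (by linarith)).trans ?_
    gcongr
    have hs : t * ((q : ℝ) + c / t) = t * q + c := by field_simp
    refine volume_le_card_of_subset_cubes _ ?_
    rintro z ⟨hz, hz0, hz1⟩
    refine ⟨fun i => ⌈z i⌉₊, hG' q hq _ (fun i => ?_) ?_, fun i => ⟨?_, Nat.le_ceil _⟩⟩
    · have : ⌈z i⌉₊ ≤ q - 1 := Nat.ceil_le.mpr (by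
        rw [Nat.cast_sub (by omega)]; simpa using hz1 i)
      omega
    · rw [← hs]
      exact smul_set_mem_of_le hup (mul_pos ht hpos) hz fun i => Nat.le_ceil _
    · linarith [Nat.ceil_lt_add_one (hz0 i)]
  have hlim : ∀ a : ℝ, Tendsto (fun q : ℕ => (((q : ℝ) + a) ^ n) / (q : ℝ) ^ n) atTop (𝓝 1) := by
    intro a
    have h1 : Tendsto (fun q : ℕ => (1 + a / (q : ℝ)) ^ n) atTop (𝓝 1) := by
      simpa using ((tendsto_const_div_atTop_nhds_zero_nat a).const_add 1).pow n
    refine h1.congr' ?_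
    filter_upwards [eventually_gt_atTop 0] with q hq
    have : (q : ℝ) ≠ 0 := by positivity
    rw [← div_pow]
    congr 1
    field_simp
  have hu : Tendsto (fun q : ℕ => (((q : ℝ) - 1) ^ n * V + ((q : ℝ) ^ n - ((q : ℝ) - 1) ^ n)) /
      (q : ℝ) ^ n) atTop (𝓝 V) := by
    have := ((hlim (-1)).mul_const V).add ((hlim 0).sub (hlim (-1)))
    simp only [one_mul, sub_self, add_zero] at this
    refine this.congr fun q => ?_
    rw [← sub_eq_add_neg]
    ring
  have hl : Tendsto (fun q : ℕ => (((q : ℝ) + c / t) ^ n * V -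
      (((q : ℝ) + c / t) ^ n - ((q : ℝ) - 1) ^ n)) / (q : ℝ) ^ n) atTop (𝓝 V) := by
    have := ((hlim (c / t)).mul_const V).sub ((hlim (c / t)).sub (hlim (-1)))
    simp only [one_mul, sub_self, sub_zero] at this
    refine this.congr fun q => ?_
    rw [← sub_eq_add_neg]
    ring
  refine tendsto_of_tendsto_of_tendsto_of_le_of_le' hl hu ?_ ?_
  · filter_upwards [eventually_ge_atTop 2] with q hq
    exact div_le_div_of_nonneg_right (hlower q hq) (by positivity)
  · filter_upwards [eventually_ge_atTop 2] with q hq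
    exact div_le_div_of_nonneg_right (hupper q hq) (by positivity)

theorem Convex.volume_real_smul_closure_inter {C : Set (ι → ℝ)} (hC : Convex ℝ C) {t : ℝ}
    (ht : t ≠ 0) (A : Set (ι → ℝ)) :
    volume.real (t • closure C ∩ A) = volume.real (t • C ∩ A) := by
  refine measureReal_congr ?_
  have h0 : volume (t • closure C \ t • C) = 0 := by
    rw [← Set.smul_set_sdiff₀ ht, Measure.addHaar_smul]
    have : volume (closure C \ C) = 0 := by
      refine measure_mono_null (fun x hx => ?_) (hC.addHaar_frontier volume)
      exact ⟨hx.1, fun h => hx.2 (interior_subset h)⟩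
    rw [this, mul_zero]
  refine (ae_eq_set.mpr ⟨h0, ?_⟩).inter (ae_eq_refl A)
  rw [Set.sdiff_eq_empty.mpr (Set.smul_set_mono subset_closure), measure_empty]

end LatticePointCount

/-! ### Monomials in monomial ideals and their powers. -/

section MonomialIdeals

variable {σ k : Type*} [Field k]

/-- Series supported on exponents above B form an ideal: a coefficient of a product at w only
involves coefficients at exponents below w. -/
theorem MvPowerSeries.exists_le_of_mem_span_monomial {B : Set (σ →₀ ℕ)} {f : MvPowerSeries σ k}
    (hf : f ∈ Ideal.span ((fun u => MvPowerSeries.monomial u (1 : k)) '' B)) {w : σ →₀ ℕ}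
    (hw : MvPowerSeries.coeff w f ≠ 0) : ∃ v ∈ B, v ≤ w := by
  classical
  by_contra! hB
  refine hw ?_
  clear hw
  induction hf using Submodule.span_induction generalizing w with
  | mem x hx =>
    obtain ⟨v, hv, rfl⟩ := hx
    exact MvPowerSeries.coeff_monomial_ne (fun h => hB v hv h.ge) 1
  | zero => simp
  | add x y _ _ ihx ihy => rw [map_add, ihx hB, ihy hB, add_zero]
  | smul a x _ ih =>
    rw [smul_eq_mul, MvPowerSeries.coeff_mul]
    refine Finset.sum_eq_zero fun ij hij => ?_
    rw [ih, mul_zero]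
    intro v hv hle
    refine hB v hv (hle.trans ?_)
    rw [← Finset.HasAntidiagonal.mem_antidiagonal.mp hij]
    exact le_add_self

theorem MvPowerSeries.monomial_mem_of_le {I : Ideal (MvPowerSeries σ k)} {v w : σ →₀ ℕ}
    (hv : MvPowerSeries.monomial v (1 : k) ∈ I) (h : v ≤ w) :
    MvPowerSeries.monomial w (1 : k) ∈ I := by
  rw [← tsub_add_cancel_of_le h, ← one_mul (1 : k), ← MvPowerSeries.monomial_mul_monomial]
  exact I.mul_mem_left _ hv

theorem MvPowerSeries.span_monomial_pow (A : Set (σ →₀ ℕ)) (N : ℕ) :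
    Ideal.span ((fun u => MvPowerSeries.monomial u (1 : k)) '' A) ^ N =
      Ideal.span ((fun u => MvPowerSeries.monomial u (1 : k)) '' (N • A)) := by
  induction N with
  | zero => simp [MvPowerSeries.monomial_zero_one]
  | succ N ih =>
    rw [pow_succ, ih, Ideal.span_mul_span', succ_nsmul]
    congr 1
    ext f
    simp only [Set.mem_mul, Set.mem_image, Set.mem_add]
    constructor
    · rintro ⟨_, ⟨a, ha, rfl⟩, _, ⟨b, hb, rfl⟩, rfl⟩
      exact ⟨a + b, ⟨a, ha, b, hb, rfl⟩, by rw [MvPowerSeries.monomial_mul_monomial, one_mul]⟩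
    · rintro ⟨_, ⟨a, ha, b, hb, rfl⟩, rfl⟩
      exact ⟨_, ⟨a, ha, rfl⟩, _, ⟨b, hb, rfl⟩, by
        rw [MvPowerSeries.monomial_mul_monomial, one_mul]⟩

end MonomialIdeals

/-! ### Powers of a monomial ideal and dilates of the exponent hull. -/

section ExponentHull

variable {n : ℕ} {k : Type*} [Field k]

/-- The convex hull of the exponents of the monomials in `𝔞`. -/
def exponentHull (𝔞 : Ideal (MvPowerSeries (Fin n) k)) : Set (Fin n → ℝ) :=
  convexHull ℝ
    {v | ∃ u : Fin n →₀ ℕ, MvPowerSeries.monomial u (1 : k) ∈ 𝔞 ∧ v = fun i => (u i : ℝ)}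

variable (𝔞 : Ideal (MvPowerSeries (Fin n) k))

theorem newtonPolyhedron_eq_closure_exponentHull :
    newtonPolyhedron 𝔞 = closure (exponentHull 𝔞) :=
  closedConvexHull_eq_closure_convexHull

theorem convex_exponentHull : Convex ℝ (exponentHull 𝔞) := convex_convexHull ℝ _

variable {𝔞}

theorem nonneg_of_mem_exponentHull {x : Fin n → ℝ} (hx : x ∈ exponentHull 𝔞) : 0 ≤ x := by
  have : exponentHull 𝔞 ⊆ Set.Ici 0 := convexHull_min
    (fun v ⟨u, _, hv⟩ => hv ▸ fun i => Nat.cast_nonneg (u i)) (convex_Ici 0)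
  exact this hx

/-- The exponent set, hence its hull, is stable under integer steps along a coordinate axis. A real
step c is reached by convexity between the steps 0 and ⌈c⌉. -/
theorem add_single_mem_exponentHull {x : Fin n → ℝ} (hx : x ∈ exponentHull 𝔞) (i : Fin n)
    {c : ℝ} (hc : 0 ≤ c) : x + Pi.single i c ∈ exponentHull 𝔞 := by
  have hnat : ∀ m : ℕ, ∀ x ∈ exponentHull 𝔞, x + Pi.single i (m : ℝ) ∈ exponentHull 𝔞 := by
    intro m
    have : exponentHull 𝔞 ⊆ (fun z => z + Pi.single i (m : ℝ)) ⁻¹' exponentHull 𝔞 := by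
      refine convexHull_min ?_ ((convex_exponentHull 𝔞).translate_preimage_left _)
      rintro v ⟨u, hu, rfl⟩
      refine subset_convexHull ℝ _ ⟨u + Finsupp.single i m,
        MvPowerSeries.monomial_mem_of_le hu le_self_add, ?_⟩
      funext j
      simp [Finsupp.single_apply, Pi.single_apply, eq_comm]
    exact fun x hx => this hx
  rcases hc.eq_or_lt with rfl | hc
  · simpa using hx
  have hm : 0 < (⌈c⌉₊ : ℝ) := hc.trans_le (Nat.le_ceil c)
  refine (convex_exponentHull 𝔞).segment_subset hx (hnat ⌈c⌉₊ x hx)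
    ⟨1 - c / ⌈c⌉₊, c / ⌈c⌉₊, ?_, by positivity, by ring, ?_⟩
  · rw [sub_nonneg, div_le_one hm]
    exact Nat.le_ceil c
  · funext j
    by_cases h : j = i
    · subst h
      simp
      field_simp
      ring
    · simp [Pi.single_eq_of_ne h]
      ring

theorem mem_exponentHull_of_le {x y : Fin n → ℝ} (hx : x ∈ exponentHull 𝔞) (hxy : x ≤ y) :
    y ∈ exponentHull 𝔞 := by
  have h : ∀ s : Finset (Fin n), x + ∑ i ∈ s, Pi.single i (y i - x i) ∈ exponentHull 𝔞 := by
    intro s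
    induction s using Finset.induction_on with
    | empty => simpa using hx
    | insert i s hi ih =>
      rw [Finset.sum_insert hi, add_comm (Pi.single _ _), ← add_assoc]
      exact add_single_mem_exponentHull ih i (sub_nonneg.mpr (hxy i))
  have := h Finset.univ
  rwa [Finset.univ_sum_single (fun i => y i - x i), show x + (fun i => y i - x i) = y by
    funext i; simp] at this

theorem smul_exponentHull_subset {r s : ℝ} (hr : 0 < r) (hrs : r ≤ s) :
    s • exponentHull 𝔞 ⊆ r • exponentHull 𝔞 := by
  rintro _ ⟨x, hx, rfl⟩
  refine ⟨(s / r) • x, mem_exponentHull_of_le hx fun i => ?_, ?_⟩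
  · exact le_mul_of_one_le_left (nonneg_of_mem_exponentHull hx i) ((one_le_div hr).mpr hrs)
  · change r • (s / r) • x = s • x
    rw [smul_smul, mul_div_cancel₀ _ hr.ne']

theorem natCast_mem_exponentHull {v : Fin n →₀ ℕ}
    (hv : MvPowerSeries.monomial v (1 : k) ∈ 𝔞) : (fun i => (v i : ℝ)) ∈ exponentHull 𝔞 :=
  subset_convexHull ℝ _ ⟨v, hv, rfl⟩

/-- The multiplier starts at 1: for empty A, `0 • A` is {0}, while a dilate of an empty hull is
empty. -/
theorem nsmul_exponents_subset {A : Set (Fin n →₀ ℕ)}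
    (hA : ∀ u ∈ A, MvPowerSeries.monomial u (1 : k) ∈ 𝔞) (N : ℕ) {v : Fin n →₀ ℕ}
    (hv : v ∈ (N + 1) • A) :
    (fun i => (v i : ℝ)) ∈ ((N : ℝ) + 1) • exponentHull 𝔞 := by
  induction N generalizing v with
  | zero =>
    rw [zero_add, one_nsmul] at hv
    simpa using natCast_mem_exponentHull (hA v hv)
  | succ N ih =>
    rw [succ_nsmul] at hv
    obtain ⟨a, ha, b, hb, rfl⟩ := hv
    -- Convexity gives (N+1)C + C = (N+2)C.
    rw [(convex_exponentHull 𝔞).add_smul (by positivity) zero_le_one]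
    refine ⟨_, by simpa using ih ha, fun i => (b i : ℝ), ?_, ?_⟩
    · simpa using natCast_mem_exponentHull (hA b hb)
    · funext i
      simp

theorem mem_smul_exponentHull_of_monomial_mem_pow (h𝔞 : IsMonomialIdeal 𝔞) {N : ℕ} (hN : N ≠ 0)
    {w : Fin n →₀ ℕ} (hw : MvPowerSeries.monomial w (1 : k) ∈ 𝔞 ^ N) :
    (fun i => (w i : ℝ)) ∈ (N : ℝ) • exponentHull 𝔞 := by
  obtain ⟨A, rfl⟩ := h𝔞
  obtain ⟨N, rfl⟩ := Nat.exists_eq_succ_of_ne_zero hN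
  rw [MvPowerSeries.span_monomial_pow] at hw
  obtain ⟨v, hv, hvw⟩ := MvPowerSeries.exists_le_of_mem_span_monomial hw (w := w) (by simp)
  have := nsmul_exponents_subset (k := k) (𝔞 := Ideal.span _)
    (fun u hu => Ideal.subset_span (Set.mem_image_of_mem _ hu)) N hv
  rw [Nat.succ_eq_add_one, Nat.cast_succ]
  exact smul_set_mem_of_le (fun x hx y hxy => mem_exponentHull_of_le hx hxy) (by positivity) this
    fun i => Nat.cast_le.mpr (hvw i)

/-- By Carathéodory, w = M ∑ c_i u_i with at most n+1 exponents u_i. Rounding each M c_i down loses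
at most n+1 in total, so M = N+n+1 leaves at least N factors x^(u_i) whose product divides x^w. -/
theorem monomial_mem_pow_of_mem_smul_exponentHull {N : ℕ} {w : Fin n →₀ ℕ}
    (hw : (fun i => (w i : ℝ)) ∈ ((N : ℝ) + n + 1) • exponentHull 𝔞) :
    MvPowerSeries.monomial w (1 : k) ∈ 𝔞 ^ N := by
  obtain ⟨x, hx, hxw⟩ := hw
  obtain ⟨ι, _, z, c, hz, hind, hc, hsum, hzx⟩ := eq_pos_convex_span_of_mem_convexHull hx
  have hcard : Fintype.card ι ≤ n + 1 := by
    simpa using hind.card_le_finrank_succ.trans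
      (Nat.add_le_add_right (Submodule.finrank_le _) 1)
  have hz' : ∀ i, ∃ u : Fin n →₀ ℕ, MvPowerSeries.monomial u (1 : k) ∈ 𝔞 ∧
      z i = fun j => (u j : ℝ) := fun i => hz ⟨i, rfl⟩
  choose u hu hzu using hz'
  let M : ℝ := (N : ℝ) + n + 1
  have hM : 0 ≤ M := by positivity
  let m : ι → ℕ := fun i => ⌊M * c i⌋₊
  have hmN : N ≤ ∑ i, m i := by
    have h1 : M ≤ ∑ i, ((m i : ℝ) + 1) := by
      calc M = ∑ i, M * c i := by rw [← Finset.mul_sum, hsum, mul_one]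
        _ ≤ _ := Finset.sum_le_sum fun i _ => (Nat.lt_floor_add_one _).le
    rw [Finset.sum_add_distrib] at h1
    have h2 : (Fintype.card ι : ℝ) ≤ n + 1 := by exact_mod_cast hcard
    simp only [Finset.sum_const, Finset.card_univ, nsmul_eq_mul, mul_one, M] at h1
    have : (N : ℝ) ≤ ((∑ i, m i : ℕ) : ℝ) := by
      push_cast
      linarith
    exact_mod_cast this
  have hle : ∑ i, m i • u i ≤ w := by
    intro j
    have : ((∑ i, m i * u i j : ℕ) : ℝ) ≤ w j := by
      have hwj := congrFun hxw j
      simp only [← hzx, hzu] at hwj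
      rw [← hwj]
      simp only [Pi.smul_apply, Finset.sum_apply, smul_eq_mul, Finset.mul_sum]
      push_cast
      refine Finset.sum_le_sum fun i _ => ?_
      rw [← mul_assoc]
      exact mul_le_mul_of_nonneg_right (Nat.floor_le (mul_nonneg hM (hc i).le))
        (Nat.cast_nonneg _)
    simpa [Finsupp.finsetSum_apply] using (Nat.cast_le (α := ℝ)).mp this
  refine MvPowerSeries.monomial_mem_of_le (Ideal.pow_le_pow_right hmN ?_) hle
  have hprod : MvPowerSeries.monomial (∑ i, m i • u i) (1 : k) =
      ∏ i, MvPowerSeries.monomial (u i) (1 : k) ^ m i := by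
    simp_rw [MvPowerSeries.monomial_pow, one_pow]
    rw [MvPowerSeries.prod_monomial, Finset.prod_const_one]
  rw [hprod, ← Finset.prod_pow_eq_pow_sum]
  exact Ideal.prod_mem_prod fun i _ => Ideal.pow_mem_pow (hu i) _

end ExponentHull

/-! ### Splitting numbers read off from a basis. -/

section SplittingNumber

variable {p : ℕ} [Fact p.Prime] {R : Type*} [CommRing R] [CharP R p] {e : ℕ}

/-- The projections φ_j are dual to the generators x_j of their summands. If a combination of the
φ_j vanishes under ε on the basis elements in s, it does so on the whole basis, by `hs`, hence
everywhere; evaluating at x_j kills the j-th coefficient. So the φ_j give independent vectors in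
K^s. -/
theorem card_isDSummand_le {K ι : Type*} [Field K] [Fintype ι] (ε : R →+* K)
    (hε : Function.Surjective ε) (B : Module.Basis ι R (FPush p e R)) (s : Finset ι)
    {De : AddSubgroup (CartierMap p R e)} (hs : ∀ φ ∈ De, ∀ i ∉ s, ε (φ (B i)) = 0)
    {m : ℕ} (M : Fin m → Submodule R (FPush p e R)) (hM : DirectSum.IsInternal M) :
    Nat.card {j : Fin m // IsDSummand p De M hM j} ≤ s.card := by
  classical
  choose f hf using fun j : {j : Fin m // IsDSummand p De M hM j} => j.2
  set E := LinearEquiv.ofBijective (DirectSum.coeLinearMap M) hM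
  let φ : {j : Fin m // IsDSummand p De M hM j} → CartierMap p R e := fun j =>
    (f j).toLinearMap ∘ₗ DirectSum.component R (Fin m) (fun i => M i) j ∘ₗ E.symm.toLinearMap
  let x : {j : Fin m // IsDSummand p De M hM j} → FPush p e R := fun j => (f j).symm 1
  have hφx : ∀ i j, φ i (x j) = if i = j then 1 else 0 := by
    intro i j
    have : E.symm (x j) = DirectSum.lof R (Fin m) (fun i => M i) j ((f j).symm 1) := by
      rw [LinearEquiv.symm_apply_eq]
      exact (DirectSum.coeLinearMap_lof M j.1 ((f j).symm 1)).symm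
    simp only [φ, LinearMap.comp_apply, LinearEquiv.coe_coe, this]
    split_ifs with h
    · subst h
      simp [DirectSum.component.lof_self]
    · rw [DirectSum.component.of, dif_neg (fun h' => h (Subtype.ext h'.symm)), map_zero]
  let V : {j : Fin m // IsDSummand p De M hM j} → (s → K) := fun j i => ε (φ j (B i))
  have hV : LinearIndependent K V := by
    rw [Fintype.linearIndependent_iff]
    intro c hc j
    choose c' hc' using fun j => hε (c j)
    let ψ : CartierMap p R e := ∑ j, c' j • φ j
    have hψ : ∀ i, ε (ψ (B i)) = 0 := by
      intro i
      have hsum : ε (ψ (B i)) = ∑ j, c j * ε (φ j (B i)) := by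
        simp [ψ, LinearMap.sum_apply, hc']
      rw [hsum]
      by_cases hi : i ∈ s
      · simpa [V] using congrFun hc ⟨i, hi⟩
      · exact Finset.sum_eq_zero fun j _ => by rw [hs _ (hf j) i hi, mul_zero]
    have hψ' : ε (ψ (x j)) = 0 := by
      rw [← B.sum_repr (x j), map_sum, map_sum]
      exact Finset.sum_eq_zero fun i _ => by rw [map_smul, smul_eq_mul, map_mul, hψ, mul_zero]
    simpa [ψ, LinearMap.sum_apply, hφx, hc'] using hψ'
  rw [Nat.card_eq_fintype_card]
  simpa using hV.fintype_card_le_finrank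

theorem Module.Basis.exists_isInternal_span_singleton {m : ℕ}
    (B : Module.Basis (Fin m) R (FPush p e R)) (De : AddSubgroup (CartierMap p R e)) :
    ∃ (M : Fin m → Submodule R (FPush p e R)) (hM : DirectSum.IsInternal M),
      ∀ i, B.coord i ∈ De → IsDSummand p De M hM i := by
  classical
  let M : Fin m → Submodule R (FPush p e R) := fun i => Submodule.span R {B i}
  have hM : DirectSum.IsInternal M := by
    refine DirectSum.isInternal_submodule_of_iSupIndep_of_iSup_eq_top
      B.linearIndependent.iSupIndep_span_singleton ?_
    rw [← B.span_eq, Submodule.span_range_eq_iSup]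
  refine ⟨M, hM, fun i hi => ?_⟩
  have hmem : ∀ j, B j ∈ M j := fun j => Submodule.mem_span_singleton_self _
  have hbij : Function.Bijective (B.coord i ∘ₗ (M i).subtype) := by
    constructor
    · rw [← LinearMap.ker_eq_bot, LinearMap.ker_eq_bot']
      rintro ⟨y, hy⟩ h
      obtain ⟨c, rfl⟩ := Submodule.mem_span_singleton.mp hy
      simp only [LinearMap.comp_apply, Submodule.subtype_apply, map_smul, Module.Basis.coord_apply,
        Module.Basis.repr_self, Finsupp.single_eq_same, smul_eq_mul, mul_one] at h
      simp [h]
    · intro c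
      exact ⟨c • ⟨B i, hmem i⟩, by simp⟩
  -- With the coordinate itself as isomorphism from the line to R, the projection becomes `B.coord
  -- i`.
  refine ⟨LinearEquiv.ofBijective _ hbij, ?_⟩
  convert hi
  refine B.ext fun j => ?_
  have : (LinearEquiv.ofBijective (DirectSum.coeLinearMap M) hM).symm (B j) =
      DirectSum.lof R (Fin m) (fun i => M i) j ⟨B j, hmem j⟩ := by
    rw [LinearEquiv.symm_apply_eq]
    exact (DirectSum.coeLinearMap_lof M j ⟨B j, hmem j⟩).symm
  simp only [LinearMap.comp_apply, LinearEquiv.coe_coe, this, LinearEquiv.ofBijective_apply,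
    DirectSum.component.of, Module.Basis.coord_apply]
  split_ifs with h
  · subst h
    simp
  · simp [Finsupp.single_eq_of_ne' h]

/-- If `F^e_* R` has a basis such that the coordinate functions in `s` lie in `𝒟_e`, and modulo the
kernel of `ε` all elements of `𝒟_e` vanish on the other basis elements, then `a_e = #s`. -/
theorem splittingNumber_eq_card {K ι : Type*} [Field K] [Fintype ι] (ε : R →+* K)
    (hε : Function.Surjective ε) (B : Module.Basis ι R (FPush p e R)) (s : Finset ι)
    {De : AddSubgroup (CartierMap p R e)} (hs : ∀ φ ∈ De, ∀ i ∉ s, ε (φ (B i)) = 0)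
    (hs' : ∀ i ∈ s, B.coord i ∈ De) :
    splittingNumber p De = s.card := by
  refine IsGreatest.csSup_eq ⟨?_, ?_⟩
  · let f := Fintype.equivFin ι
    obtain ⟨M, hM, h⟩ := (B.reindex f).exists_isInternal_span_singleton De
    refine ⟨_, M, hM, le_antisymm ?_ (card_isDSummand_le ε hε B s hs M hM)⟩
    have hf : ∀ i : s, IsDSummand p De M hM (f i) := fun i => h _ (by
      convert hs' i i.2
      ext x
      simp)
    simpa using Nat.card_le_card_of_injective
      (fun i : s => (⟨f i, hf i⟩ : {j // IsDSummand p De M hM j})) fun i j hij =>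
        Subtype.ext (f.injective (congrArg Subtype.val hij))
  · rintro N ⟨m, M, hM, rfl⟩
    exact card_isDSummand_le ε hε B s hs M hM

end SplittingNumber

/-! ### The monomial basis of F^e_* k⟦x⟧. -/

section MonomialBasis

variable (p : ℕ) [Fact p.Prime] {k : Type*} [Field k] [CharP k p] {n : ℕ} (e : ℕ)

/-- A vector of digits, as an exponent. -/
def digitExponent {n q : ℕ} (u : Fin n → Fin q) : Fin n →₀ ℕ :=
  Finsupp.equivFunOnFinite.symm fun i => (u i : ℕ)

@[simp]
theorem digitExponent_apply {q : ℕ} (u : Fin n → Fin q) (i : Fin n) :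
    digitExponent u i = u i := rfl

theorem smul_add_digitExponent_inj {q : ℕ} {a b : Fin n →₀ ℕ} {u v : Fin n → Fin q} :
    q • a + digitExponent u = q • b + digitExponent v ↔ a = b ∧ u = v := by
  refine ⟨fun h => ?_, fun ⟨h, h'⟩ => by rw [h, h']⟩
  have key : ∀ i, a i = b i ∧ (u i : ℕ) = v i := by
    intro i
    have hi : q * a i + u i = q * b i + v i := by simpa using DFunLike.congr_fun h i
    have hq : 0 < q := (u i).pos
    have h1 := congrArg (· / q) hi
    have h2 := congrArg (· % q) hi
    simp only [Nat.mul_add_div hq, Nat.div_eq_of_lt (u i).isLt, Nat.div_eq_of_lt (v i).isLt,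
      Nat.mul_add_mod, Nat.mod_eq_of_lt (u i).isLt, Nat.mod_eq_of_lt (v i).isLt, add_zero] at h1 h2
    exact ⟨h1, h2⟩
  exact ⟨Finsupp.ext fun i => (key i).1, funext fun i => Fin.ext (key i).2⟩

theorem exists_smul_add_digitExponent {q : ℕ} (hq : 0 < q) (d : Fin n →₀ ℕ) :
    ∃ (a : Fin n →₀ ℕ) (u : Fin n → Fin q), d = q • a + digitExponent u :=
  ⟨Finsupp.equivFunOnFinite.symm fun i => d i / q, fun i => ⟨d i % q, Nat.mod_lt _ hq⟩,
    Finsupp.ext fun i => by simp [Nat.div_add_mod]⟩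

/-- Only exponents divisible by q = p^e occur in r^q, so multiplication by r^q preserves residues of
exponents mod q. This is what makes `monomialCoord` linear. -/
theorem coeff_frobenius_pow_mul (r f : MvPowerSeries (Fin n) k) (d : Fin n →₀ ℕ)
    (u : Fin n → Fin (p ^ e)) :
    MvPowerSeries.coeff (p ^ e • d + digitExponent u) (r ^ p ^ e * f) =
      ∑ ab ∈ Finset.HasAntidiagonal.antidiagonal d, MvPowerSeries.coeff ab.1 r ^ p ^ e *
        MvPowerSeries.coeff (p ^ e • ab.2 + digitExponent u) f := by
  have hp : p ≠ 0 := (Fact.out : p.Prime).ne_zero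
  have hq : 0 < p ^ e := pow_pos (Nat.pos_of_ne_zero hp) e
  have : ExpChar k p := ExpChar.prime Fact.out
  rw [MvPowerSeries.coeff_mul, ← MvPowerSeries.map_iterateFrobenius_expand p hp]
  symm
  refine Finset.sum_of_injOn (fun ab => (p ^ e • ab.1, p ^ e • ab.2 + digitExponent u)) ?_ ?_ ?_ ?_
  · rintro ⟨a, b⟩ _ ⟨a', b'⟩ _ h
    simp only [Prod.mk.injEq, smul_add_digitExponent_inj] at h
    have ha : a = a' := by
      ext i
      have := DFunLike.congr_fun h.1 i
      simpa [(Fact.out : p.Prime).ne_zero] using this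
    rw [ha, h.2.1]
  · rintro ⟨a, b⟩ hab
    simp only [Finset.mem_coe, Finset.HasAntidiagonal.mem_antidiagonal] at hab ⊢
    rw [← hab, smul_add, add_assoc]
  · rintro ⟨a, b⟩ hab hnot
    rw [Finset.HasAntidiagonal.mem_antidiagonal] at hab
    by_cases hdvd : ∀ i, p ^ e ∣ a i
    · exfalso
      choose a' ha' using hdvd
      obtain rfl : a = p ^ e • Finsupp.equivFunOnFinite.symm a' := Finsupp.ext fun i => by
        simp [ha']
      obtain ⟨b', v, rfl⟩ := exists_smul_add_digitExponent hq b
      rw [← add_assoc, ← smul_add, smul_add_digitExponent_inj] at hab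
      refine hnot ⟨(Finsupp.equivFunOnFinite.symm a', b'), ?_, ?_⟩
      · rw [Finset.mem_coe, Finset.HasAntidiagonal.mem_antidiagonal]
        exact hab.1
      · simp [hab.2]
    · push Not at hdvd
      obtain ⟨i, hi⟩ := hdvd
      rw [MvPowerSeries.coeff_map, MvPowerSeries.coeff_expand_of_not_dvd _ _ _ hi, map_zero,
        zero_mul]
  · rintro ⟨a, b⟩ _
    simp [MvPowerSeries.coeff_map, MvPowerSeries.coeff_expand_smul, iterateFrobenius_def]

/-- The power series with coefficients `c`. -/
def MvPowerSeries.ofCoeff (c : (Fin n →₀ ℕ) → k) : MvPowerSeries (Fin n) k := c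

@[simp]
theorem MvPowerSeries.coeff_ofCoeff (c : (Fin n →₀ ℕ) → k) (d : Fin n →₀ ℕ) :
    MvPowerSeries.coeff d (MvPowerSeries.ofCoeff c) = c d := rfl

variable {p e} {J : Type*} (κ : Module.Basis J k (FPush p e k))

/-- The coordinates of `F^e_* f` with respect to the basis `λ_j x^u` of `F^e_* k⟦x⟧`, where `λ` is
a basis of `F^e_* k` and `u` is a vector of digits. -/
def monomialCoord :
    FPush p e (MvPowerSeries (Fin n) k) →ₗ[MvPowerSeries (Fin n) k]
      (J × (Fin n → Fin (p ^ e)) → MvPowerSeries (Fin n) k) where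
  toFun f ju := MvPowerSeries.ofCoeff fun d => κ.repr (FPush.of p e k (MvPowerSeries.coeff
    (p ^ e • d + digitExponent ju.2) ((FPush.of p e _).symm f))) ju.1
  map_add' f g := by
    funext ju
    ext d
    simp
  map_smul' r f := by
    funext ⟨j, u⟩
    ext d
    obtain ⟨f, rfl⟩ := (FPush.of p e _).surjective f
    rw [FPush.smul_of, RingHom.id_apply, Pi.smul_apply, smul_eq_mul, MvPowerSeries.coeff_mul]
    change κ.repr (FPush.of p e k (MvPowerSeries.coeff (p ^ e • d + digitExponent u)
      (r ^ p ^ e * f))) j = _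
    rw [coeff_frobenius_pow_mul, map_sum, map_sum, Finsupp.finsetSum_apply]
    refine Finset.sum_congr rfl fun ab _ => ?_
    rw [← FPush.smul_of, map_smul, Finsupp.smul_apply, smul_eq_mul, MvPowerSeries.coeff_ofCoeff,
      AddEquiv.symm_apply_apply]

theorem coeff_monomialCoord (f : MvPowerSeries (Fin n) k) (j : J) (u : Fin n → Fin (p ^ e))
    (d : Fin n →₀ ℕ) :
    MvPowerSeries.coeff d (monomialCoord κ (FPush.of p e _ f) (j, u)) =
      κ.repr (FPush.of p e k (MvPowerSeries.coeff (p ^ e • d + digitExponent u) f)) j := rfl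

variable [Fintype J]

/-- Each exponent is uniquely qa + u with u a vector of digits, so the coordinates record every
coefficient exactly once and can be prescribed freely. -/
theorem monomialCoord_bijective :
    Function.Bijective (monomialCoord (n := n) κ) := by
  have hq : 0 < p ^ e := pow_pos (Fact.out : p.Prime).pos e
  constructor
  · rw [← LinearMap.ker_eq_bot, LinearMap.ker_eq_bot']
    intro f hf
    obtain ⟨f, rfl⟩ := (FPush.of p e _).surjective f
    suffices f = 0 by rw [this, map_zero]
    ext d
    obtain ⟨a, u, rfl⟩ := exists_smul_add_digitExponent hq d
    rw [map_zero, ← (FPush.of p e k).map_eq_zero_iff, ← κ.repr.map_eq_zero_iff]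
    ext j
    rw [← coeff_monomialCoord, hf]
    simp
  · intro g
    choose a u hau using exists_smul_add_digitExponent (n := n) hq
    refine ⟨FPush.of p e _ <| MvPowerSeries.ofCoeff fun d => (FPush.of p e k).symm
      (κ.equivFun.symm fun j => MvPowerSeries.coeff (a d) (g (j, u d))), ?_⟩
    funext ⟨j, v⟩
    ext d
    rw [coeff_monomialCoord]
    obtain ⟨h1, h2⟩ := smul_add_digitExponent_inj.mp (hau (p ^ e • d + digitExponent v))
    rw [MvPowerSeries.coeff_ofCoeff, AddEquiv.apply_symm_apply, ← κ.equivFun_apply,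
      LinearEquiv.apply_symm_apply, ← h1, ← h2]

/-- The basis `λ_j x^u` of `F^e_* k⟦x⟧`. -/
def monomialBasis :
    Module.Basis (J × (Fin n → Fin (p ^ e))) (MvPowerSeries (Fin n) k)
      (FPush p e (MvPowerSeries (Fin n) k)) :=
  Module.Basis.ofEquivFun (LinearEquiv.ofBijective _ (monomialCoord_bijective κ))

theorem monomialBasis_repr (f : FPush p e (MvPowerSeries (Fin n) k))
    (ju : J × (Fin n → Fin (p ^ e))) :
    (monomialBasis κ).repr f ju = monomialCoord κ f ju := by
  rw [← Module.Basis.equivFun_apply, monomialBasis, Module.Basis.equivFun_ofEquivFun]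
  rfl

theorem monomialBasis_apply (j : J) (u : Fin n → Fin (p ^ e)) :
    monomialBasis κ (j, u) = FPush.of p e _
      (MvPowerSeries.monomial (digitExponent u) ((FPush.of p e k).symm (κ j))) := by
  classical
  apply (monomialBasis κ).repr.injective
  ext ⟨j', v⟩ d
  rw [Module.Basis.repr_self, monomialBasis_repr, coeff_monomialCoord, MvPowerSeries.coeff_monomial]
  have := smul_add_digitExponent_inj (a := d) (b := 0) (u := v) (v := u)
  rw [smul_zero, zero_add] at this
  simp only [this]
  by_cases hd : d = 0
  · by_cases hv : v = u
    · by_cases hj : j' = j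
      · simp [hd, hv, hj]
      · simp [hd, hv, hj]
    · simp [hv]
  · rw [if_neg (by simp [hd])]
    rw [Finsupp.single_apply]
    split_ifs
    · simp [MvPowerSeries.coeff_one, hd]
    · simp

theorem monomialBasis_coord_comp_mulMap (j : J) (u v : Fin n → Fin (p ^ e)) {w : Fin n →₀ ℕ}
    (h : digitExponent u = w + digitExponent v) :
    (monomialBasis κ).coord (j, u) ∘ₗ FPush.mulMap p e (MvPowerSeries.monomial w (1 : k)) =
      (monomialBasis κ).coord (j, v) := by
  ext f d
  obtain ⟨f, rfl⟩ := (FPush.of p e _).surjective f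
  rw [LinearMap.comp_apply, Module.Basis.coord_apply, Module.Basis.coord_apply, monomialBasis_repr,
    monomialBasis_repr]
  change MvPowerSeries.coeff d (monomialCoord κ (FPush.of p e _
    (MvPowerSeries.monomial w 1 * f)) (j, u)) = _
  rw [coeff_monomialCoord, coeff_monomialCoord, h, add_left_comm,
    MvPowerSeries.coeff_add_monomial_mul, one_mul]

end MonomialBasis

/-! ### The Cartier algebra of a pair. -/

section PairCartier

variable {p : ℕ} [Fact p.Prime] {R : Type*} [CommRing R] [CharP R p]

theorem comp_mulMap_mem_cartierMulIdeal {e : ℕ} {I : Ideal R} (φ : CartierMap p R e) {b : R}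
    (hb : b ∈ I) : φ ∘ₗ FPush.mulMap p e b ∈ cartierMulIdeal p e I :=
  AddSubgroup.subset_closure ⟨φ, b, hb, rfl⟩

/-- A factor b outside ψ moves inside as b^(p^e₂), by linearity of ψ. -/
theorem cartierMul_comp_mulMap {e₁ e₂ : ℕ} (φ : CartierMap p R e₁) (ψ : CartierMap p R e₂)
    (b c : R) :
    cartierMul p (φ ∘ₗ FPush.mulMap p e₁ b) (ψ ∘ₗ FPush.mulMap p e₂ c) =
      cartierMul p φ ψ ∘ₗ FPush.mulMap p (e₁ + e₂) (b ^ p ^ e₂ * c) := by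
  ext x
  obtain ⟨x, rfl⟩ := (FPush.of p _ R).surjective x
  change φ (FPush.of p e₁ R (b * ψ (FPush.of p e₂ R (c * x)))) =
    φ (FPush.of p e₁ R (ψ (FPush.of p e₂ R (b ^ p ^ e₂ * c * x))))
  rw [mul_assoc, ← FPush.smul_of, map_smul, smul_eq_mul]

theorem cartierMul_mem_of_pow_mul_le {e₁ e₂ : ℕ} {I₁ I₂ I : Ideal R}
    (hI : ∀ b ∈ I₁, ∀ c ∈ I₂, b ^ p ^ e₂ * c ∈ I)
    {φ : CartierMap p R e₁} {ψ : CartierMap p R e₂}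
    (hφ : φ ∈ cartierMulIdeal p e₁ I₁) (hψ : ψ ∈ cartierMulIdeal p e₂ I₂) :
    cartierMul p φ ψ ∈ cartierMulIdeal p (e₁ + e₂) I := by
  induction hφ using AddSubgroup.closure_induction with
  | mem φ h =>
    obtain ⟨φ, b, hb, rfl⟩ := h
    induction hψ using AddSubgroup.closure_induction with
    | mem ψ h =>
      obtain ⟨ψ, c, hc, rfl⟩ := h
      rw [cartierMul_comp_mulMap]
      exact comp_mulMap_mem_cartierMulIdeal _ (hI b hb c hc)
    | zero =>
      convert (cartierMulIdeal p (e₁ + e₂) I).zero_mem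
      ext x
      exact map_zero (φ ∘ₗ FPush.mulMap p e₁ b)
    | add ψ ψ' _ _ h h' =>
      convert (cartierMulIdeal p (e₁ + e₂) I).add_mem h h'
      ext x
      exact map_add (φ ∘ₗ FPush.mulMap p e₁ b) _ _
    | neg ψ _ h =>
      convert (cartierMulIdeal p (e₁ + e₂) I).neg_mem h
      ext x
      exact map_neg (φ ∘ₗ FPush.mulMap p e₁ b) _
  | zero => exact (cartierMulIdeal p (e₁ + e₂) I).zero_mem
  | add φ φ' _ _ h h' => exact (cartierMulIdeal p (e₁ + e₂) I).add_mem h h'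
  | neg φ _ h => exact (cartierMulIdeal p (e₁ + e₂) I).neg_mem h

theorem pairCartier_zero (𝔞 : Ideal R) (t : ℝ) : pairCartier p 𝔞 t 0 = ⊤ := by
  rw [eq_top_iff]
  intro φ _
  have h : φ ∘ₗ FPush.mulMap p 0 (1 : R) ∈ pairCartier p 𝔞 t 0 :=
    comp_mulMap_mem_cartierMulIdeal φ (by simp)
  convert h
  ext x
  obtain ⟨x, rfl⟩ := (FPush.of p _ R).surjective x
  change _ = φ (FPush.of p 0 R (1 * x))
  -- In degree 0 the power of 𝔞 is ⌈t · 0⌉ = 0, so b = 1 is allowed.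
  rw [one_mul]

theorem cartierMul_mem_pairCartier (𝔞 : Ideal R) (t : ℝ) {e₁ e₂ : ℕ}
    {φ : CartierMap p R e₁} {ψ : CartierMap p R e₂} (hφ : φ ∈ pairCartier p 𝔞 t e₁)
    (hψ : ψ ∈ pairCartier p 𝔞 t e₂) : cartierMul p φ ψ ∈ pairCartier p 𝔞 t (e₁ + e₂) := by
  refine cartierMul_mem_of_pow_mul_le (fun b hb c hc => ?_) hφ hψ
  set N₁ := ⌈t * ((p : ℝ) ^ e₁ - 1)⌉₊
  set N₂ := ⌈t * ((p : ℝ) ^ e₂ - 1)⌉₊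
  have h := Ideal.mul_mem_mul (Ideal.pow_mem_pow hb (p ^ e₂)) hc
  rw [← pow_mul, ← pow_add] at h
  -- The required inequality rests on t(q₁ - 1)q₂ + t(q₂ - 1) = t(q₁q₂ - 1), with q_i = p^e_i.
  refine Ideal.pow_le_pow_right (Nat.ceil_le.mpr ?_) h
  have h1 : t * ((p : ℝ) ^ e₁ - 1) ≤ N₁ := Nat.le_ceil _
  have h2 : t * ((p : ℝ) ^ e₂ - 1) ≤ N₂ := Nat.le_ceil _
  have h3 := mul_le_mul_of_nonneg_right h1 (pow_nonneg (Nat.cast_nonneg (α := ℝ) p) e₂)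
  push_cast
  rw [pow_add]
  linarith

end PairCartier

/-! ### Splitting numbers of monomial pairs and their asymptotics. -/

section MonomialSplitting

variable {p : ℕ} [Fact p.Prime] {k : Type*} [Field k] [CharP k p] {n : ℕ}

theorem isCartierSubalgebra_pairCartier (hk : IsFFinite p k) {𝔞 : Ideal (MvPowerSeries (Fin n) k)}
    (h𝔞 : 𝔞 ≠ ⊥) (t : ℝ) : IsCartierSubalgebra p (pairCartier p 𝔞 t) where
  zero_eq_top := pairCartier_zero 𝔞 t
  mul_mem := cartierMul_mem_pairCartier 𝔞 t
  exists_ne_bot := by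
    have : Module.Finite k (FPush p 1 k) := hk
    refine ⟨1, one_pos, fun h => ?_⟩
    obtain ⟨b, hb, hb0⟩ := Submodule.exists_mem_ne_zero_of_ne_bot
      (pow_ne_zero ⌈t * ((p : ℝ) ^ 1 - 1)⌉₊ h𝔞)
    let B := monomialBasis (n := n) (Module.finBasis k (FPush p 1 k))
    -- If degree 1 vanished, evaluating `B.coord i` premultiplied by b at 1 would kill all
    -- coordinates of b ≠ 0.
    have hB : ∀ i, B.coord i (FPush.of p 1 _ b) = 0 := by
      intro i
      have hmem := comp_mulMap_mem_cartierMulIdeal (B.coord i) hb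
      rw [pairCartier] at h
      rw [h, AddSubgroup.mem_bot] at hmem
      have := LinearMap.congr_fun hmem (FPush.of p 1 _ 1)
      change B.coord i (FPush.of p 1 _ (b * 1)) = 0 at this
      rwa [mul_one] at this
    rw [B.forall_coord_eq_zero_iff] at hB
    exact hb0 ((FPush.of p 1 _).map_eq_zero_iff.mp hB)

/-- The exponents in `[0, q - 1]^n` of the monomials of an ideal. -/
def smallExponents (q : ℕ) (I : Ideal (MvPowerSeries (Fin n) k)) : Finset (Fin n → ℕ) :=
  open Classical in
  (Fintype.piFinset fun _ => Finset.range q).filter fun w =>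
    MvPowerSeries.monomial (Finsupp.equivFunOnFinite.symm w) (1 : k) ∈ I

theorem mem_smallExponents {q : ℕ} {I : Ideal (MvPowerSeries (Fin n) k)} {w : Fin n → ℕ} :
    w ∈ smallExponents q I ↔ (∀ i, w i < q) ∧
      MvPowerSeries.monomial (Finsupp.equivFunOnFinite.symm w) (1 : k) ∈ I := by
  simp [smallExponents]

/-- Modulo the maximal ideal, φ sees only the coefficients of b x^u at digit vectors v. A nonzero
one gives a generator exponent w ≤ v - u ≤ q-1-u, forcing x^(q-1-u) into the ideal; `Fin.rev` is the
digit q-1-u. -/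
theorem apply_monomialBasis_of_mem_cartierMulIdeal {e : ℕ} {J : Type*} [Fintype J]
    (κ : Module.Basis J k (FPush p e k)) (B : Set (Fin n →₀ ℕ))
    {φ : CartierMap p (MvPowerSeries (Fin n) k) e}
    (hφ : φ ∈ cartierMulIdeal p e
      (Ideal.span ((fun u => MvPowerSeries.monomial u (1 : k)) '' B)))
    (j : J) (u : Fin n → Fin (p ^ e))
    (hu : MvPowerSeries.monomial (digitExponent fun i => (u i).rev) (1 : k) ∉
      Ideal.span ((fun u => MvPowerSeries.monomial u (1 : k)) '' B)) :
    MvPowerSeries.constantCoeff (φ (monomialBasis κ (j, u))) = 0 := by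
  classical
  induction hφ using AddSubgroup.closure_induction with
  | mem φ h =>
    obtain ⟨φ, b, hb, rfl⟩ := h
    rw [monomialBasis_apply]
    change MvPowerSeries.constantCoeff (φ (FPush.of p e _
      (b * MvPowerSeries.monomial (digitExponent u) ((FPush.of p e k).symm (κ j))))) = 0
    set f := b * MvPowerSeries.monomial (digitExponent u) ((FPush.of p e k).symm (κ j)) with hf
    rw [← (monomialBasis κ).sum_repr (FPush.of p e _ f), map_sum, map_sum]
    refine Finset.sum_eq_zero fun ⟨j', v⟩ _ => ?_
    rw [map_smul, smul_eq_mul, map_mul, monomialBasis_repr,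
      ← MvPowerSeries.coeff_zero_eq_constantCoeff_apply, coeff_monomialCoord, smul_zero, zero_add]
    suffices MvPowerSeries.coeff (digitExponent v) f = 0 by
      rw [this, map_zero, map_zero, Finsupp.zero_apply, zero_mul]
    rw [hf, MvPowerSeries.coeff_mul_monomial]
    split_ifs with huv
    · by_contra hne
      obtain ⟨w, hw, hwle⟩ := MvPowerSeries.exists_le_of_mem_span_monomial hb
        (left_ne_zero_of_mul hne)
      refine hu (MvPowerSeries.monomial_mem_of_le (Ideal.subset_span ⟨w, hw, rfl⟩) fun i => ?_)
      have h1 : w i ≤ v i - u i := hwle i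
      have h2 := (v i).isLt
      simp only [digitExponent_apply, Fin.val_rev]
      omega
    · rfl
  | zero => simp
  | add φ ψ _ _ h h' => rw [LinearMap.add_apply, map_add, h, h', add_zero]
  | neg φ _ h => rw [LinearMap.neg_apply, map_neg, h, neg_zero]

theorem coord_mem_cartierMulIdeal {e : ℕ} {J : Type*} [Fintype J]
    (κ : Module.Basis J k (FPush p e k)) {I : Ideal (MvPowerSeries (Fin n) k)}
    (j : J) (u : Fin n → Fin (p ^ e))
    (hu : MvPowerSeries.monomial (digitExponent fun i => (u i).rev) (1 : k) ∈ I) :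
    (monomialBasis κ).coord (j, u) ∈ cartierMulIdeal p e I := by
  have hq : 0 < p ^ e := pow_pos (Fact.out : p.Prime).pos e
  -- The coordinate at u is the one at the top digit vector (q-1, …, q-1) premultiplied by
  -- x^(q-1-u).
  rw [← monomialBasis_coord_comp_mulMap κ j (fun _ => ⟨p ^ e - 1, by omega⟩) u
    (w := digitExponent fun i => (u i).rev)]
  · exact comp_mulMap_mem_cartierMulIdeal _ hu
  · ext i
    have := (u i).isLt
    simp only [Finsupp.add_apply, digitExponent_apply, Fin.val_rev]
    omega

/-- `a_e` for the degree `e` part `𝒞_e · F^e_* I`, where `I` is a monomial ideal. -/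
theorem splittingNumber_cartierMulIdeal (hk : IsFFinite p k) (e : ℕ)
    {I : Ideal (MvPowerSeries (Fin n) k)} (hI : IsMonomialIdeal I) :
    splittingNumber p (cartierMulIdeal p e I) =
      Module.finrank k (FPush p e k) * (smallExponents (p ^ e) I).card := by
  classical
  have := (FPush.finite_and_finrank p k hk e).1
  let κ := Module.finBasis k (FPush p e k)
  let s : Finset (Fin n → Fin (p ^ e)) := Finset.univ.filter fun u =>
    MvPowerSeries.monomial (digitExponent fun i => (u i).rev) (1 : k) ∈ I
  have hs : s.card = (smallExponents (p ^ e) I).card := by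
    refine Finset.card_bij (fun u _ i => ((u i).rev : ℕ)) ?_ ?_ ?_
    · intro u hu
      rw [mem_smallExponents]
      exact ⟨fun i => Fin.isLt _, (Finset.mem_filter.mp hu).2⟩
    · intro u _ v _ huv
      exact funext fun i => Fin.rev_injective (Fin.ext (congrFun huv i))
    · intro w hw
      obtain ⟨hlt, hmem⟩ := mem_smallExponents.mp hw
      refine ⟨fun i => Fin.rev ⟨w i, hlt i⟩, ?_, ?_⟩
      · rw [Finset.mem_filter]
        refine ⟨Finset.mem_univ _, ?_⟩
        simp only [Fin.rev_rev]
        exact hmem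
      · simp only [Fin.rev_rev]
  rw [splittingNumber_eq_card (s := Finset.univ ×ˢ s) MvPowerSeries.constantCoeff
    (fun a => ⟨MvPowerSeries.C a, MvPowerSeries.constantCoeff_C a⟩) (monomialBasis (n := n) κ),
    Finset.card_product, hs]
  · simp
  · obtain ⟨B, rfl⟩ := hI
    rintro φ hφ ⟨j, u⟩ hju
    refine apply_monomialBasis_of_mem_cartierMulIdeal κ B hφ j u fun h => hju ?_
    simpa [s] using h
  · rintro ⟨j, u⟩ hju
    exact coord_mem_cartierMulIdeal κ j u (by simpa [s] using hju)

theorem IsMonomialIdeal.pow {𝔞 : Ideal (MvPowerSeries (Fin n) k)} (h𝔞 : IsMonomialIdeal 𝔞)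
    (N : ℕ) : IsMonomialIdeal (𝔞 ^ N) := by
  obtain ⟨A, rfl⟩ := h𝔞
  exact ⟨N • A, MvPowerSeries.span_monomial_pow A N⟩

theorem tendsto_card_smallExponents {𝔞 : Ideal (MvPowerSeries (Fin n) k)}
    (h𝔞 : IsMonomialIdeal 𝔞) {t : ℝ} (ht : 0 < t) :
    Tendsto (fun q : ℕ => ((smallExponents q (𝔞 ^ ⌈t * ((q : ℝ) - 1)⌉₊)).card : ℝ) / (q : ℝ) ^ n)
      atTop (𝓝 (volume.real (t • newtonPolyhedron 𝔞 ∩ Set.Icc (0 : Fin n → ℝ) 1))) := by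
  rw [newtonPolyhedron_eq_closure_exponentHull,
    (convex_exponentHull 𝔞).volume_real_smul_closure_inter ht.ne']
  -- Since N = ⌈t(q-1)⌉ < tq + 1, the factor N+n+1 is at most tq + (n+2). The bounds are needed only
  -- for q ≥ 2, where N > 0; at q = 1 the power is the unit ideal.
  have := tendsto_card_lattice_points (C := exponentHull 𝔞)
    (fun x hx y hxy => mem_exponentHull_of_le hx hxy) ht (c := n + 2) (by positivity)
    (fun q => smallExponents q (𝔞 ^ ⌈t * ((q : ℝ) - 1)⌉₊))
    (fun q w hw => (mem_smallExponents.mp hw).1) ?_ ?_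
  · simpa only [Fintype.card_fin] using this
  · intro q hq w hw
    have hq' : (2 : ℝ) ≤ q := by exact_mod_cast hq
    have hpos : 0 < t * ((q : ℝ) - 1) := mul_pos ht (by linarith)
    exact smul_exponentHull_subset hpos (Nat.le_ceil _) (mem_smul_exponentHull_of_monomial_mem_pow
      h𝔞 (Nat.ceil_pos.mpr hpos).ne' (mem_smallExponents.mp hw).2)
  · intro q hq w hlt hw
    have hq' : (2 : ℝ) ≤ q := by exact_mod_cast hq
    have hpos : 0 < t * ((q : ℝ) - 1) := mul_pos ht (by linarith)
    refine mem_smallExponents.mpr ⟨hlt, monomial_mem_pow_of_mem_smul_exponentHull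
      (smul_exponentHull_subset (by positivity) ?_ hw)⟩
    have := Nat.ceil_lt_add_one hpos.le
    linarith

end MonomialSplitting

end

theorem theorem4p17 (p : ℕ) [Fact p.Prime] (k : Type*) [Field k] [CharP k p]
    (hk : IsFFinite p k) (n : ℕ) (𝔞 : Ideal (MvPowerSeries (Fin n) k))
    (h𝔞 : IsMonomialIdeal 𝔞) (t : ℝ) (ht : 0 < t) :
    (𝔞 ≠ ⊥ → IsCartierSubalgebra p (pairCartier p 𝔞 t)) ∧
      HasFSignature p (pairCartier p 𝔞 t)
        (volume.real (t • newtonPolyhedron 𝔞 ∩ Set.Icc (0 : Fin n → ℝ) 1)) := by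
  refine ⟨fun h0 => isCartierSubalgebra_pairCartier hk h0 t, ?_⟩
  have hlim : Tendsto (fun e : ℕ => (splittingNumber p (pairCartier p 𝔞 t e) : ℝ) /
      (p : ℝ) ^ ((e : ℝ) * ((krullDimNat (MvPowerSeries (Fin n) k) : ℝ) +
        alphaInv p (MvPowerSeries (Fin n) k)))) atTop
      (𝓝 (volume.real (t • newtonPolyhedron 𝔞 ∩ Set.Icc (0 : Fin n → ℝ) 1))) := by
    refine ((tendsto_card_smallExponents h𝔞 ht).comp
      (tendsto_pow_atTop_atTop_of_one_lt (Fact.out : p.Prime).one_lt)).congr fun e => ?_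
    have := (FPush.finite_and_finrank p k hk e).1
    have : Nontrivial (FPush p e k) := inferInstanceAs (Nontrivial k)
    have hd : (Module.finrank k (FPush p e k) : ℝ) ≠ 0 := by
      exact_mod_cast (Module.finrank_pos (R := k) (M := FPush p e k)).ne'
    rw [rpow_mul_krullDimNat_add_alphaInv p k hk, pairCartier,
      splittingNumber_cartierMulIdeal hk e (h𝔞.pow _), Nat.cast_mul, mul_comm,
      mul_div_mul_right _ _ hd, Function.comp_apply, Nat.cast_pow]
  -- The limit exists along all e, hence along Γ; if Γ is finite, the quotients are eventually 0 and
  -- so is the volume.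
  refine ⟨hlim.mono_left inf_le_left, fun hfin => tendsto_nhds_unique hlim ?_⟩
  refine tendsto_const_nhds.congr' ?_
  rw [← Nat.cofinite_eq_atTop]
  filter_upwards [hfin.compl_mem_cofinite] with e he
  have : splittingNumber p (pairCartier p 𝔞 t e) = 0 := not_not.mp he
  rw [this, Nat.cast_zero, zero_div]
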